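/- Let $1\le s\le n$ be integers, let $C$ be a real symmetric positive definite $n\times n$ matrix with smallest eigenvalue $\lambda_{\min}(C)$, and let $0\le t\le\lambda_{\min}(C)$. For $X$ in the cone $\mathcal S^n_+$ of real symmetric positive semidefinite $n\times n$ matrices, let $\lambda(X)=(\lambda_1(X),\dots,\lambda_n(X))$ be the vector of its eigenvalues in nonincreasing order, and put $$\Phi_s(X;t)=\sum_{i=1}^{s}\log\bigl(\lambda_i(X)+t\bigr)\in[-\infty,\infty),\qquad \log 0=-\infty .$$ For $y\in\mathbb R^n_{\ge 0}$ with entries $y^{\downarrow}_1\ge\dots\ge y^{\downarrow}_n$ in nonincreasing order, let $k$ be the unique integer with $0\le k\le s-1$ and $$y^{\downarrow}_k>\frac1{s-k}\sum_{i=k+1}^{n}y^{\downarrow}_i\ge y^{\downarrow}_{k+1}$$ (with $y^{\downarrow}_0=\infty$), and define $$\psi_s(y)=\sum_{i=1}^{k}\log y^{\downarrow}_i+(s-k)\log\Bigl(\frac{1}{s-k}\sum_{i=k+1}^{n}y^{\downarrow}_i\Bigr).$$ Let $\mathbb I_s\in\mathbb R^n$ be the vector whose first $s$ entries are $1$ and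 whose other entries are $0$. Then the concave envelope $\widehat\Phi_s(\cdot\,;t)$ of $\Phi_s(\cdot\,;t)$ on $\mathcal S^n_+$, that is, the pointwise infimum of all concave functions $g:\mathcal S^n_+\to[-\infty,\infty]$ with $g\ge\Phi_s(\cdot\,;t)$ on $\mathcal S^n_+$ (where concave means that the hypograph is convex), is given by $$\widehat\Phi_s(X;t)=\psi_s\bigl(\lambda(X)+t\,\mathbb I_s\bigr)\qquad\text{for every }X\in\mathcal S^n_+ .$$ -/

import Mathlib

noncomputable section

/-- The natural logarithm of a nonnegative real number as an extended real number, with the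
convention `log 0 = -∞`. -/
def extLog (x : ℝ) : EReal := ENNReal.log (ENNReal.ofReal x)

/-- The vector of eigenvalues of a real symmetric `n × n` matrix, with multiplicities, in
nonincreasing order (`0` if the matrix is not symmetric). The entry with index `i` is the
`(i + 1)`-st largest eigenvalue. -/
def sortedEigenvalues {n : ℕ} (X : Matrix (Fin n) (Fin n) ℝ) : Fin n → ℝ :=
  open Classical in
  if h : X.IsHermitian then
    fun i => h.eigenvalues₀ (Fin.cast (Fintype.card_fin n).symm i)
  else 0

/-- The smallest eigenvalue of a real symmetric `n × n` matrix (`n ≥ 1`). -/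
def lambdaMin {n : ℕ} (X : Matrix (Fin n) (Fin n) ℝ) : ℝ := ⨅ i, sortedEigenvalues X i

/-- `Φ_s(X; t) = ∑_{i ≤ s} log (λ_i(X) + t)`, with values in `[-∞, ∞)`. -/
def phi {n : ℕ} (s : ℕ) (X : Matrix (Fin n) (Fin n) ℝ) (t : ℝ) : EReal :=
  ∑ i ∈ Finset.univ.filter (fun i : Fin n => (i : ℕ) < s), extLog (sortedEigenvalues X i + t)

/-- The entries of a vector in nonincreasing order. -/
def sortDesc {n : ℕ} (y : Fin n → ℝ) : Fin n → ℝ := y ∘ Tuple.sort (fun i => -y i)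

/-- The sum of all but the `k` largest entries of `y`. -/
def tailSum {n : ℕ} (y : Fin n → ℝ) (k : ℕ) : ℝ :=
  ∑ i ∈ Finset.univ.filter (fun i : Fin n => k ≤ (i : ℕ)), sortDesc y i

/-- `0 ≤ k ≤ s - 1` and `y↓_k > (∑_{i > k} y↓_i) / (s - k) ≥ y↓_{k+1}`, where `y↓_0 = ∞`, that is,
the first inequality is void for `k = 0`. The entry `y↓_j` has the index `j - 1` in `Fin n`. -/
def IsPsiIndex {n : ℕ} (s : ℕ) (y : Fin n → ℝ) (k : ℕ) : Prop :=
  k < s ∧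
  (∀ i : Fin n, (i : ℕ) + 1 = k → tailSum y k / ((s : ℝ) - (k : ℝ)) < sortDesc y i) ∧
  (∀ i : Fin n, (i : ℕ) = k → sortDesc y i ≤ tailSum y k / ((s : ℝ) - (k : ℝ)))

/-- `ψ_s(y) = ∑_{i ≤ k} log y↓_i + (s - k) log ((∑_{i > k} y↓_i) / (s - k))`, with values in
`[-∞, ∞)`, where `k` is the index in `IsPsiIndex`; it exists and is unique for `1 ≤ s ≤ n` and
`y ≥ 0` by `existsUnique_isPsiIndex` below. -/
def psi {n : ℕ} (s : ℕ) (y : Fin n → ℝ) : EReal :=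
  open Classical in
  if h : ∃ k, IsPsiIndex s y k then
    (∑ i ∈ Finset.univ.filter (fun i : Fin n => (i : ℕ) < h.choose), extLog (sortDesc y i)) +
      (s - h.choose) • extLog (tailSum y h.choose / ((s : ℝ) - (h.choose : ℝ)))
  else 0

/-- The vector in `ℝⁿ` with the first `s` entries equal to `1` and the others equal to `0`. -/
def firstOnes (n s : ℕ) : Fin n → ℝ := fun i => if (i : ℕ) < s then 1 else 0

/-- Concavity on a convex set `S` of a function with values in `[-∞, ∞]`: the hypograph over `S`
is convex. -/
def ExtConcaveOn {E : Type*} [AddCommGroup E] [Module ℝ E] (S : Set E) (g : E → EReal) : Prop :=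
  Convex ℝ S ∧ Convex ℝ {p : E × ℝ | p.1 ∈ S ∧ (p.2 : EReal) ≤ g p.1}

/-- The concave envelope of `f` on `S`: the pointwise infimum of all functions that are concave
on `S` and at least `f` there. -/
def concaveEnvelope {E : Type*} [AddCommGroup E] [Module ℝ E] (S : Set E) (f : E → EReal) (x : E) :
    EReal :=
  ⨅ g ∈ {g : E → EReal | ExtConcaveOn S g ∧ ∀ y ∈ S, f y ≤ g y}, g x

lemma sortDesc_antitone {n : ℕ} (y : Fin n → ℝ) : Antitone (sortDesc y) := by
  intro i j hij
  have h := Tuple.monotone_sort (fun i => -y i) hij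
  simpa [sortDesc] using h

lemma tailSum_eq_add {n : ℕ} (y : Fin n → ℝ) (k : Fin n) :
    tailSum y k = sortDesc y k + tailSum y (k + 1) := by
  unfold tailSum
  rw [← Finset.sum_insert (s := Finset.univ.filter fun i : Fin n => (k : ℕ) + 1 ≤ i) (by simp)]
  congr 1
  ext i
  simp only [Finset.mem_filter, Finset.mem_univ, true_and, Finset.mem_insert, Fin.ext_iff]
  omega

/-- The index in the definition of `psi` exists and is unique. -/
theorem existsUnique_isPsiIndex {n s : ℕ} (hs : 1 ≤ s) (hsn : s ≤ n) (y : Fin n → ℝ)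
    (hy : ∀ i, 0 ≤ y i) : ∃! k, IsPsiIndex s y k := by
  classical
  -- the second condition alone, without division
  let P : ℕ → Prop := fun k =>
    k < s ∧ ∀ i : Fin n, (i : ℕ) = k → ((s : ℝ) - k) * sortDesc y i ≤ tailSum y k
  have hnn : ∀ i, 0 ≤ sortDesc y i := fun i => hy _
  have hP : ∃ k, P k := by
    refine ⟨s - 1, by omega, fun i hi => ?_⟩
    have h1 : ((s : ℝ) - ((s - 1 : ℕ) : ℝ)) = 1 := by
      rw [Nat.cast_sub hs]; simp
    have h2 := tailSum_eq_add y i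
    have h3 : 0 ≤ tailSum y (i + 1) := Finset.sum_nonneg fun j _ => hnn j
    rw [h1, ← hi]
    linarith
  have pos : ∀ k, k < s → (0 : ℝ) < (s : ℝ) - k := fun k hk => by
    have : (k : ℝ) < s := by exact_mod_cast hk
    linarith
  refine ⟨Nat.find hP, ?_, ?_⟩
  · have hf := Nat.find_spec hP
    refine ⟨hf.1, fun i hi => ?_, fun i hi => ?_⟩
    · have hm := Nat.find_min hP (m := i) (by omega)
      have hlt : (i : ℕ) < s := by have := hf.1; omega
      have h4 : tailSum y i < ((s : ℝ) - (i : ℕ)) * sortDesc y i := by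
        by_contra hc
        refine hm ⟨hlt, fun j hj => ?_⟩
        rw [Fin.ext hj]
        exact not_lt.mp hc
      rw [div_lt_iff₀ (pos _ hf.1), ← hi]
      have h2 := tailSum_eq_add y i
      push_cast
      nlinarith
    · rw [le_div_iff₀ (pos _ hf.1), mul_comm]
      exact hf.2 i hi
  · intro k hk
    have hPk : P k := ⟨hk.1, fun i hi => by
      have := hk.2.2 i hi
      rwa [le_div_iff₀ (pos _ hk.1), mul_comm] at this⟩
    have hle := Nat.find_min' hP hPk
    by_contra hne
    -- the second condition persists for larger indices
    have step : ∀ j, Nat.find hP ≤ j → j < s → P j := by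
      intro j hj
      induction j, hj using Nat.le_induction with
      | base => exact fun _ => Nat.find_spec hP
      | succ m hm ih =>
        intro hms
        have h5 := (ih (by omega)).2 ⟨m, by omega⟩ rfl
        have h2 := tailSum_eq_add y ⟨m, by omega⟩
        refine ⟨hms, fun i hi => ?_⟩
        have h6 : sortDesc y i ≤ sortDesc y ⟨m, by omega⟩ :=
          sortDesc_antitone y (by rw [Fin.le_def]; simp only; omega)
        have h7 := mul_le_mul_of_nonneg_left h6 (pos (m + 1) hms).le
        push_cast at h7 ⊢
        simp only at h2
        nlinarith
    obtain ⟨m, rfl⟩ : ∃ m, k = m + 1 := ⟨k - 1, by omega⟩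
    have hks := hk.1
    have h5 := (step m (by omega) (by omega)).2 ⟨m, by omega⟩ rfl
    have h2 := tailSum_eq_add y ⟨m, by omega⟩
    have h8 := hk.2.1 ⟨m, by omega⟩ rfl
    rw [div_lt_iff₀ (pos _ hks)] at h8
    push_cast at h8
    simp only at h2
    nlinarith

end

/-! Put `y = λ(X) + t 𝕀_s` and let `c` be the mean `(∑_{i>k} y_i)/(s-k)`. The envelope is squeezed
between affine majorants of `phi` and an explicit convex combination.

Upper bound: the tangent inequality `log x ≤ w x - log w - 1`, summed over the `s` largest
eigenvalues, together with von Neumann's trace inequality (`sum_mul_sortedEigenvalues_le_trace`),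
shows that each `U diag(w) Uᵀ` with `w` positive and nondecreasing gives an affine majorant
(`phi_le_affine`). If `U` diagonalizes `X` and `w` is `1/y_i` on the first `k` entries and `1/c` on
the rest, its value at `X` is `ψ_s(y)`. If `c = 0`, small positive numbers replace `c` and push the
bound to `-∞`.

Lower bound, for `c > 0`: the eigenvalues of `X` beyond the `k`-th lie in `[0, a]` with `a = c - t`
and sum to `(s-k) a`. Divided by `a` (if `a > 0`) they form a point of a hypersimplex, hence a
convex combination of 0/1 vectors with `s-k` ones (`hypersimplex_subset_of_convex`). So `X` is a
convex combination of matrices with the same eigenvectors and the same top `k` eigenvalues, whose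
other eigenvalues are `a` (`s-k` times) and `0`. At each of them `phi` equals `ψ_s(y)`. -/

/-! ### Orthogonal diagonalization and sorted spectra -/

open Matrix in
theorem exists_orthogonal_diagonalization {n : ℕ} {X : Matrix (Fin n) (Fin n) ℝ}
    (hX : X.IsHermitian) : ∃ U : Matrix (Fin n) (Fin n) ℝ, U * Uᵀ = 1 ∧ Uᵀ * U = 1 ∧
      X = U * diagonal (sortedEigenvalues X) * Uᵀ := by
  let e : Fin (Fintype.card (Fin n)) ≃ Fin n := Fintype.equivOfCardEq (Fintype.card_fin _)
  let π : Equiv.Perm (Fin n) := e.symm.trans (finCongr (Fintype.card_fin n))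
  have hev : hX.eigenvalues = sortedEigenvalues X ∘ π := by
    funext i
    simp only [sortedEigenvalues, dif_pos hX, Function.comp, IsHermitian.eigenvalues]
    rfl
  let V : Matrix (Fin n) (Fin n) ℝ := hX.eigenvectorUnitary
  have hV1 : V * Vᵀ = 1 := by
    simpa [star_eq_conjTranspose] using Unitary.mul_star_self_of_mem hX.eigenvectorUnitary.2
  have hV2 : Vᵀ * V = 1 := by
    simpa [star_eq_conjTranspose] using Unitary.star_mul_self_of_mem hX.eigenvectorUnitary.2
  have hXV : X = V * diagonal (sortedEigenvalues X ∘ π) * Vᵀ := by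
    have h := hX.spectral_theorem
    rw [Unitary.conjStarAlgAut_apply, hev] at h
    simpa [star_eq_conjTranspose] using h
  have hD : diagonal (sortedEigenvalues X) =
      (diagonal (sortedEigenvalues X ∘ π)).submatrix π.symm π.symm := by
    rw [submatrix_diagonal_equiv]
    simp [Function.comp_def]
  refine ⟨V.submatrix id π.symm, ?_, ?_, ?_⟩
  · rw [transpose_submatrix, submatrix_mul_equiv, hV1, submatrix_id_id]
  · rw [transpose_submatrix, ← submatrix_mul _ _ _ id _ Function.bijective_id, hV2,
      submatrix_one_equiv]
  · rw [hD, transpose_submatrix, submatrix_mul_equiv, submatrix_mul_equiv, ← hXV, submatrix_id_id]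

theorem antitone_sortedEigenvalues {n : ℕ} (X : Matrix (Fin n) (Fin n) ℝ) :
    Antitone (sortedEigenvalues X) := by
  intro i j hij
  unfold sortedEigenvalues
  split_ifs with h
  · exact h.eigenvalues₀_antitone hij
  · rfl

theorem sortedEigenvalues_nonneg {n : ℕ} {X : Matrix (Fin n) (Fin n) ℝ} (hX : X.PosSemidef)
    (i : Fin n) : 0 ≤ sortedEigenvalues X i := by
  have h := hX.eigenvalues_nonneg
    ((Fintype.equivOfCardEq (Fintype.card_fin _)) (Fin.cast (Fintype.card_fin n).symm i))
  rw [sortedEigenvalues, dif_pos hX.1]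
  simpa [Matrix.IsHermitian.eigenvalues] using h

theorem eq_of_antitone_of_map_eq {n : ℕ} {u v : Fin n → ℝ} (hu : Antitone u) (hv : Antitone v)
    (h : Finset.univ.val.map u = Finset.univ.val.map v) : u = v := by
  simp only [Fin.univ_val_map, Multiset.coe_eq_coe] at h
  exact List.ofFn_injective (h.eq_of_pairwise' hu.sortedGE_ofFn.pairwise hv.sortedGE_ofFn.pairwise)

theorem sortDesc_eq_self {n : ℕ} {y : Fin n → ℝ} (hy : Antitone y) : sortDesc y = y := by
  have h : Tuple.sort (fun i => -y i) = Equiv.refl _ :=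
    Tuple.sort_eq_refl_iff_monotone.2 fun i j hij => neg_le_neg (hy hij)
  simp [sortDesc, h]

-- The roots of the characteristic polynomial determine the spectrum as a multiset, and a
-- nonincreasing vector is determined by its multiset of entries.
open Matrix in
theorem sortedEigenvalues_conj_diagonal {n : ℕ} {U : Matrix (Fin n) (Fin n) ℝ} (hU : Uᵀ * U = 1)
    {d v : Fin n → ℝ} (hv : Antitone v) (h : Finset.univ.val.map d = Finset.univ.val.map v) :
    sortedEigenvalues (U * diagonal d * Uᵀ) = v := by
  have hH : (U * diagonal d * Uᵀ).IsHermitian := by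
    simp [IsHermitian, conjTranspose_eq_transpose_of_trivial, Matrix.mul_assoc]
  refine eq_of_antitone_of_map_eq (antitone_sortedEigenvalues _) hv ?_
  have h1 : (U * diagonal d * Uᵀ).charpoly.roots = Finset.univ.val.map d := by
    rw [charpoly_mul_comm, ← Matrix.mul_assoc, hU, Matrix.one_mul, charpoly_diagonal]
    have h1 := Polynomial.roots_multiset_prod_X_sub_C (Finset.univ.val.map d)
    rwa [Multiset.map_map] at h1
  have h2 := hH.roots_charpoly_eq_eigenvalues₀
  rw [← h, ← h1, h2]
  simp only [Fin.univ_val_map, Multiset.coe_eq_coe, sortedEigenvalues, dif_pos hH]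
  have h3 : ∀ {m : ℕ} (hm : n = m) (f : Fin m → ℝ),
      List.ofFn (fun i : Fin n => f (Fin.cast hm i)) = List.ofFn f := by
    rintro _ rfl f
    rfl
  rw [h3]
  exact List.Perm.refl _

/-! ### Von Neumann's trace inequality -/

open Matrix in
/-- A linear combination with a doubly stochastic matrix of a monotone and an antitone vector is
smallest for the identity matrix. -/
theorem sum_mul_le_of_mem_doublyStochastic {n : ℕ} {S : Matrix (Fin n) (Fin n) ℝ}
    (hS : S ∈ doublyStochastic ℝ (Fin n)) {w l : Fin n → ℝ} (hw : Monotone w) (hl : Antitone l) :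
    ∑ i, w i * l i ≤ ∑ i, ∑ j, w i * S i j * l j := by
  let f : Matrix (Fin n) (Fin n) ℝ →ₗ[ℝ] ℝ :=
    { toFun := fun M => ∑ i, ∑ j, w i * M i j * l j
      map_add' := fun M N => by
        simp only [← Finset.sum_add_distrib]
        exact Finset.sum_congr rfl fun i _ => Finset.sum_congr rfl fun j _ => by
          simp only [Matrix.add_apply]; ring
      map_smul' := fun r M => by
        simp only [Finset.smul_sum]
        exact Finset.sum_congr rfl fun i _ => Finset.sum_congr rfl fun j _ => by
          simp only [Matrix.smul_apply, smul_eq_mul, RingHom.id_apply]; ring }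
  -- By Birkhoff's theorem it suffices to check permutation matrices, where the claim is the
  -- rearrangement inequality.
  have hconv : Convex ℝ {M | ∑ i, w i * l i ≤ f M} := convex_halfSpace_ge f.isLinear _
  have hsub : {M | ∃ σ : Equiv.Perm (Fin n), σ.permMatrix ℝ = M} ⊆
      {M | ∑ i, w i * l i ≤ f M} := by
    rintro _ ⟨σ, rfl⟩
    have hav : Antivary w l := fun i j hij => hw (le_of_not_ge fun hji => (hl hji).not_gt hij)
    have := hav.sum_mul_le_sum_mul_comp_perm (σ := σ)
    simpa [f, Equiv.Perm.permMatrix, PEquiv.toMatrix_apply, eq_comm] using this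
  have hmem : S ∈ convexHull ℝ {M | ∃ σ : Equiv.Perm (Fin n), σ.permMatrix ℝ = M} := by
    rw [← doublyStochastic_eq_convexHull_permMatrix]
    exact hS
  exact convexHull_min hsub hconv hmem

open Matrix in
/-- Von Neumann's trace inequality. -/
theorem sum_mul_sortedEigenvalues_le_trace {n : ℕ} {U Y : Matrix (Fin n) (Fin n) ℝ}
    (hU : U * Uᵀ = 1) (hU' : Uᵀ * U = 1) (hY : Y.IsHermitian) {w : Fin n → ℝ} (hw : Monotone w) :
    ∑ i, w i * sortedEigenvalues Y i ≤ (U * diagonal w * Uᵀ * Y).trace := by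
  obtain ⟨V, hV, hV', hYV⟩ := exists_orthogonal_diagonalization hY
  set l := sortedEigenvalues Y
  set Q := Uᵀ * V
  have hQ : Q * Qᵀ = 1 := by
    simp only [Q, transpose_mul, transpose_transpose]
    rw [Matrix.mul_assoc, ← Matrix.mul_assoc V, hV, Matrix.one_mul, hU']
  have hQ' : Qᵀ * Q = 1 := by
    simp only [Q, transpose_mul, transpose_transpose]
    rw [Matrix.mul_assoc, ← Matrix.mul_assoc U, hU, Matrix.one_mul, hV']
  -- The squared entries of an orthogonal matrix form a doubly stochastic matrix.
  have hS : (of fun i j => Q i j * Q i j) ∈ doublyStochastic ℝ (Fin n) := by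
    rw [mem_doublyStochastic_iff_sum]
    refine ⟨fun i j => mul_self_nonneg _, fun i => ?_, fun j => ?_⟩
    · simpa [mul_apply] using congrFun (congrFun hQ i) i
    · simpa [mul_apply] using congrFun (congrFun hQ' j) j
  refine (sum_mul_le_of_mem_doublyStochastic hS hw (antitone_sortedEigenvalues Y)).trans_eq ?_
  have htr : (U * diagonal w * Uᵀ * Y).trace = (diagonal w * Q * (diagonal l * Qᵀ)).trace := by
    conv_lhs => rw [hYV]
    simp only [Q, transpose_mul, transpose_transpose, ← Matrix.mul_assoc]
    rw [trace_mul_comm _ U]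
    simp only [← Matrix.mul_assoc]
  rw [htr]
  simp only [trace, diag_apply, mul_apply (M := diagonal w * Q), diagonal_mul, transpose_apply,
    of_apply]
  exact Finset.sum_congr rfl fun i _ => Finset.sum_congr rfl fun j _ => by ring

/-! ### Vertices of the hypersimplex -/

section Hypersimplex

variable {ι : Type*} [DecidableEq ι]

/-- The coordinates of `v` in `T` that are neither `0` nor `1`. -/
noncomputable def fractional (T : Finset ι) (v : ι → ℝ) : Finset ι := {i ∈ T | v i ≠ 0 ∧ v i ≠ 1}

/-- The vectors with entries in `[0, 1]`, supported on `T`, with sum of entries `m`. -/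
def hypersimplex (T : Finset ι) (m : ℕ) : Set (ι → ℝ) :=
  {v | (∀ i ∈ T, 0 ≤ v i ∧ v i ≤ 1) ∧ (∀ i ∉ T, v i = 0) ∧ ∑ i ∈ T, v i = m}

/-- Moves as much as possible from the coordinate `j` to the coordinate `i`. -/
noncomputable def shift (v : ι → ℝ) (i j : ι) : ι → ℝ :=
  v + min (1 - v i) (v j) • (Pi.single i 1 - Pi.single j 1)

/-- The amount moved is the largest that keeps both entries in `[0, 1]`, so entry `i` reaches `1` or
entry `j` reaches `0`, and no new fractional entry appears. -/
theorem shift_mem {T : Finset ι} {m : ℕ} {v : ι → ℝ} (hv : v ∈ hypersimplex T m) {i j : ι}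
    (hij : i ≠ j) (hi : i ∈ fractional T v) (hj : j ∈ fractional T v) :
    shift v i j ∈ hypersimplex T m ∧ (fractional T (shift v i j)).card < (fractional T v).card := by
  obtain ⟨h01, hout, hsum⟩ := hv
  have hiT := (Finset.mem_filter.1 hi).1
  have hjT := (Finset.mem_filter.1 hj).1
  have hvi := h01 i hiT
  have hvj := h01 j hjT
  have hsi : shift v i j i = v i + min (1 - v i) (v j) := by simp [shift, hij]
  have hsj : shift v i j j = v j - min (1 - v i) (v j) := by
    simp [shift, hij.symm]; ring
  have hso : ∀ l, l ≠ i → l ≠ j → shift v i j l = v l := fun l h1 h2 => by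
    simp [shift, h1, h2]
  have hd0 : 0 ≤ min (1 - v i) (v j) := le_min (by linarith) hvj.1
  have hd1 := min_le_left (1 - v i) (v j)
  have hd2 := min_le_right (1 - v i) (v j)
  refine ⟨⟨fun l hl => ?_, fun l hl => ?_, ?_⟩, Finset.card_lt_card ?_⟩
  · by_cases h1 : l = i
    · subst h1; rw [hsi]; constructor <;> linarith
    by_cases h2 : l = j
    · subst h2; rw [hsj]; constructor <;> linarith
    rw [hso l h1 h2]; exact h01 l hl
  · rw [hso l (fun h => hl (h ▸ hiT)) (fun h => hl (h ▸ hjT)), hout l hl]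
  · simp [shift, Finset.sum_add_distrib, hsum, ← Finset.mul_sum, hiT, hjT]
  · rw [Finset.ssubset_iff_of_subset]
    · rcases min_choice (1 - v i) (v j) with h | h
      · exact ⟨i, hi, by simp [fractional, hsi, h]⟩
      · exact ⟨j, hj, by simp [fractional, hsj, h]⟩
    · intro l hl
      by_cases h1 : l = i
      · rwa [h1]
      by_cases h2 : l = j
      · rwa [h2]
      simpa only [fractional, Finset.mem_filter, hso l h1 h2] using hl

/-- The entries sum to an integer, so exactly one of them cannot be fractional. -/
theorem exists_ne_mem_fractional {T : Finset ι} {m : ℕ} {v : ι → ℝ} (hv : v ∈ hypersimplex T m)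
    {i : ι} (hi : i ∈ fractional T v) : ∃ j ∈ fractional T v, i ≠ j := by
  by_contra! h
  obtain ⟨h01, -, hsum⟩ := hv
  obtain ⟨hiT, hi0, hi1⟩ := Finset.mem_filter.1 hi
  have h2 : ∑ j ∈ T.erase i, v j = ((T.erase i).filter fun j => v j = 1).card := by
    rw [Finset.card_filter, Nat.cast_sum]
    refine Finset.sum_congr rfl fun j hj => ?_
    obtain ⟨hji, hjT⟩ := Finset.mem_erase.1 hj
    by_cases hj1 : v j = 1
    · simp [hj1]
    · by_cases hj0 : v j = 0
      · simp [hj0]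
      · exact absurd (h j (Finset.mem_filter.2 ⟨hjT, hj0, hj1⟩)).symm hji
  rw [← Finset.add_sum_erase _ _ hiT, h2] at hsum
  have hpos : 0 < v i := lt_of_le_of_ne (h01 i hiT).1 (Ne.symm hi0)
  have hlt : v i < 1 := lt_of_le_of_ne (h01 i hiT).2 hi1
  generalize ((T.erase i).filter fun j => v j = 1).card = p at hsum
  have h3 : p < m := by
    have : (p : ℝ) < m := by linarith
    exact_mod_cast this
  have h4 : m < p + 1 := by
    have : (m : ℝ) < p + 1 := by linarith
    exact_mod_cast this
  omega

/-- A convex set that contains the vertices of a hypersimplex contains the hypersimplex. -/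
theorem hypersimplex_subset_of_convex {T : Finset ι} {m : ℕ} {S : Set (ι → ℝ)} (hS : Convex ℝ S)
    (h : ∀ A ⊆ T, A.card = m → (fun i => if i ∈ A then (1 : ℝ) else 0) ∈ S) :
    hypersimplex T m ⊆ S := by
  suffices H : ∀ N (v : ι → ℝ), (fractional T v).card = N → v ∈ hypersimplex T m → v ∈ S from
    fun v hv => H _ v rfl hv
  intro N
  induction N using Nat.strong_induction_on with
  | _ N ih =>
  rintro v rfl hv
  rcases (fractional T v).eq_empty_or_nonempty with he | ⟨i, hi⟩
  · have h01 : ∀ i ∈ T, v i ≠ 1 → v i = 0 := fun i hiT hi1 => by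
      by_contra hi0
      have : i ∈ fractional T v := Finset.mem_filter.2 ⟨hiT, hi0, hi1⟩
      simp [he] at this
    have hveq : v = fun i => if i ∈ T.filter (fun i => v i = 1) then (1 : ℝ) else 0 := by
      funext i
      by_cases hiT : i ∈ T
      · by_cases hi1 : v i = 1
        · simp [hiT, hi1]
        · simp [h01 i hiT hi1]
      · simp [hiT, hv.2.1 i hiT]
    have hcard : (T.filter fun i => v i = 1).card = m := by
      have h2 : ((T.filter fun i => v i = 1).card : ℝ) = m := by
        rw [← hv.2.2, Finset.card_filter, Nat.cast_sum]
        refine Finset.sum_congr rfl fun i hi => ?_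
        by_cases hi1 : v i = 1
        · simp [hi1]
        · simp [h01 i hi hi1]
      exact_mod_cast h2
    rw [hveq]
    exact h _ (Finset.filter_subset _ _) hcard
  -- The two opposite shifts between `i` and `j` have fewer fractional entries, and `v` lies on the
  -- segment joining them. The weights are inversely proportional to the distances `δ` and `ε`.
  · obtain ⟨j, hj, hij⟩ := exists_ne_mem_fractional hv hi
    obtain ⟨m1, c1⟩ := shift_mem hv hij hi hj
    obtain ⟨m2, c2⟩ := shift_mem hv hij.symm hj hi
    have s1 := ih _ c1 _ rfl m1
    have s2 := ih _ c2 _ rfl m2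
    obtain ⟨hiT, hi0, hi1⟩ := Finset.mem_filter.1 hi
    obtain ⟨hjT, hj0, hj1⟩ := Finset.mem_filter.1 hj
    have hvi := hv.1 i hiT
    have hvj := hv.1 j hjT
    unfold shift at s1 s2
    set δ := min (1 - v i) (v j)
    set ε := min (1 - v j) (v i)
    have hδ : 0 < δ := lt_min (sub_pos.2 (lt_of_le_of_ne hvi.2 hi1))
      (lt_of_le_of_ne hvj.1 (Ne.symm hj0))
    have hε : 0 < ε := lt_min (sub_pos.2 (lt_of_le_of_ne hvj.2 hj1))
      (lt_of_le_of_ne hvi.1 (Ne.symm hi0))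
    have hc := hS s1 s2 (a := ε / (ε + δ)) (b := δ / (ε + δ)) (by positivity) (by positivity)
      (by field_simp)
    convert hc using 1
    funext l
    simp only [Pi.add_apply, Pi.smul_apply, Pi.sub_apply, smul_eq_mul]
    field_simp
    ring

end Hypersimplex

/-! ### Extended logarithm and index bookkeeping -/

theorem extLog_of_pos {x : ℝ} (hx : 0 < x) : extLog x = (Real.log x : EReal) :=
  ENNReal.log_ofReal_of_pos hx

theorem extLog_of_nonpos {x : ℝ} (hx : x ≤ 0) : extLog x = ⊥ := by
  simp [extLog, ENNReal.ofReal_of_nonpos hx]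

/-- For positive `x` this is the tangent line of the logarithm at `1 / w`. -/
theorem extLog_le_coe (x : ℝ) {w : ℝ} (hw : 0 < w) :
    extLog x ≤ ((w * x - Real.log w - 1 : ℝ) : EReal) := by
  rcases le_or_gt x 0 with hx | hx
  · simp [extLog_of_nonpos hx]
  · rw [extLog_of_pos hx, EReal.coe_le_coe_iff]
    have h := Real.log_le_sub_one_of_pos (mul_pos hw hx)
    rw [Real.log_mul hw.ne' hx.ne'] at h
    linarith

theorem EReal.coe_finset_sum {ι : Type*} (T : Finset ι) (f : ι → ℝ) :
    ((∑ i ∈ T, f i : ℝ) : EReal) = ∑ i ∈ T, (f i : EReal) :=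
  map_sum (⟨⟨Real.toEReal, EReal.coe_zero⟩, EReal.coe_add⟩ : ℝ →+ EReal) f T

theorem sum_filter_lt_split {M : Type*} [AddCommMonoid M] {n k s : ℕ} (hk : k ≤ s)
    (f : Fin n → M) : ∑ i ∈ Finset.univ.filter (fun i : Fin n => (i : ℕ) < s), f i =
      ∑ i ∈ Finset.univ.filter (fun i : Fin n => (i : ℕ) < k), f i +
      ∑ i ∈ Finset.univ.filter (fun i : Fin n => k ≤ (i : ℕ) ∧ (i : ℕ) < s), f i := by
  rw [← Finset.sum_filter_add_sum_filter_not _ (fun i : Fin n => (i : ℕ) < k), Finset.filter_filter,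
    Finset.filter_filter]
  congr 2 <;> ext i <;> simp only [Finset.mem_filter, Finset.mem_univ, true_and] <;> omega

theorem sum_split {M : Type*} [AddCommMonoid M] {n : ℕ} (k : ℕ) (f : Fin n → M) :
    ∑ i, f i = ∑ i ∈ Finset.univ.filter (fun i : Fin n => (i : ℕ) < k), f i +
      ∑ i ∈ Finset.univ.filter (fun i : Fin n => k ≤ (i : ℕ)), f i := by
  rw [← Finset.sum_filter_add_sum_filter_not _ (fun i : Fin n => (i : ℕ) < k)]
  simp only [not_lt]

theorem card_filter_le_lt {n k s : ℕ} (hk : k ≤ s) (hs : s ≤ n) :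
    (Finset.univ.filter fun i : Fin n => k ≤ (i : ℕ) ∧ (i : ℕ) < s).card = s - k := by
  have h := sum_filter_lt_split hk fun _ : Fin n => 1
  simp only [← Finset.card_eq_sum_ones, Fin.card_filter_val_lt] at h
  omega

theorem psi_eq {n s k : ℕ} (hs : 1 ≤ s) (hsn : s ≤ n) {y : Fin n → ℝ} (hy : ∀ i, 0 ≤ y i)
    (hk : IsPsiIndex s y k) :
    psi s y = (∑ i ∈ Finset.univ.filter (fun i : Fin n => (i : ℕ) < k), extLog (sortDesc y i)) +
      (s - k) • extLog (tailSum y k / ((s : ℝ) - (k : ℝ))) := by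
  have h : ∃ k, IsPsiIndex s y k := ⟨k, hk⟩
  have he : h.choose = k := (existsUnique_isPsiIndex hs hsn y hy).unique h.choose_spec hk
  rw [psi, dif_pos h, he]

theorem Matrix.convex_posSemidef {n : ℕ} :
    Convex ℝ {Y : Matrix (Fin n) (Fin n) ℝ | Y.PosSemidef} :=
  fun _ hX _ hY _ _ ha hb _ => (hX.smul ha).add (hY.smul hb)

/-! ### Upper bound by affine majorants -/

theorem concaveEnvelope_le_of_affine {E : Type*} [AddCommGroup E] [Module ℝ E] {S : Set E}
    (hS : Convex ℝ S) {f : E → EReal} (L : E →ₗ[ℝ] ℝ) (b : ℝ)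
    (h : ∀ y ∈ S, f y ≤ ((L y + b : ℝ) : EReal)) (x : E) :
    concaveEnvelope S f x ≤ ((L x + b : ℝ) : EReal) := by
  refine iInf₂_le (fun y => ((L y + b : ℝ) : EReal)) ⟨⟨hS, ?_⟩, h⟩
  rintro ⟨x₁, r₁⟩ ⟨h₁, h₁'⟩ ⟨x₂, r₂⟩ ⟨h₂, h₂'⟩ a c ha hc hac
  simp only [EReal.coe_le_coe_iff] at h₁' h₂'
  refine ⟨hS h₁ h₂ ha hc hac, ?_⟩
  simp only [Prod.smul_mk, Prod.mk_add_mk, EReal.coe_le_coe_iff, map_add, map_smul, smul_eq_mul]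
  have e : b = a * b + c * b := by rw [← add_mul, hac, one_mul]
  nlinarith [mul_le_mul_of_nonneg_left h₁' ha, mul_le_mul_of_nonneg_left h₂' hc]

open Matrix in
theorem phi_le_affine {n s : ℕ} {t : ℝ} {U Y : Matrix (Fin n) (Fin n) ℝ} (hU : U * Uᵀ = 1)
    (hU' : Uᵀ * U = 1) (hY : Y.PosSemidef) {w : Fin n → ℝ} (hw : Monotone w)
    (hw0 : ∀ i, 0 < w i) :
    phi s Y t ≤ (((U * diagonal w * Uᵀ * Y).trace +
      ∑ i ∈ Finset.univ.filter (fun i : Fin n => (i : ℕ) < s),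
        (t * w i - Real.log (w i) - 1) : ℝ) : EReal) := by
  refine (Finset.sum_le_sum fun i _ => extLog_le_coe _ (hw0 i)).trans ?_
  rw [← EReal.coe_finset_sum, EReal.coe_le_coe_iff]
  have h1 := sum_mul_sortedEigenvalues_le_trace hU hU' hY.1 hw
  -- The terms with index at least `s` may be added because `w` and the eigenvalues are nonnegative.
  have h2 : ∑ i ∈ Finset.univ.filter (fun i : Fin n => (i : ℕ) < s), w i * sortedEigenvalues Y i ≤
      ∑ i, w i * sortedEigenvalues Y i :=
    Finset.sum_le_sum_of_subset_of_nonneg (Finset.filter_subset _ _) fun i _ _ =>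
      mul_nonneg (hw0 i).le (sortedEigenvalues_nonneg hY i)
  have h3 : ∑ i ∈ Finset.univ.filter (fun i : Fin n => (i : ℕ) < s),
      (w i * (sortedEigenvalues Y i + t) - Real.log (w i) - 1) =
      ∑ i ∈ Finset.univ.filter (fun i : Fin n => (i : ℕ) < s), w i * sortedEigenvalues Y i +
      ∑ i ∈ Finset.univ.filter (fun i : Fin n => (i : ℕ) < s),
        (t * w i - Real.log (w i) - 1) := by
    rw [← Finset.sum_add_distrib]
    exact Finset.sum_congr rfl fun i _ => by ring
  linarith

-- The tail condition `hct` is only an inequality, so that `c` can also be taken arbitrarily small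
-- when the tail of `y` vanishes.
open Matrix in
theorem concaveEnvelope_phi_le {n s k : ℕ} (hsn : s ≤ n) (hks : k < s) {t : ℝ}
    {X : Matrix (Fin n) (Fin n) ℝ} (hX : X.IsHermitian) {y : Fin n → ℝ} (hy : Antitone y)
    (hyX : y = sortedEigenvalues X + t • firstOnes n s) {c : ℝ} (hc0 : 0 < c)
    (hcy : ∀ i : Fin n, (i : ℕ) < k → c ≤ y i)
    (hct : ∑ i ∈ Finset.univ.filter (fun i : Fin n => k ≤ (i : ℕ)), y i ≤ ((s : ℝ) - k) * c) :
    concaveEnvelope {Y : Matrix (Fin n) (Fin n) ℝ | Y.PosSemidef} (fun Y => phi s Y t) X ≤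
      ((∑ i ∈ Finset.univ.filter (fun i : Fin n => (i : ℕ) < k), Real.log (y i) +
        ((s : ℝ) - k) * Real.log c : ℝ) : EReal) := by
  obtain ⟨U, hU, hU', hXU⟩ := exists_orthogonal_diagonalization hX
  set l := sortedEigenvalues X
  -- These are the slopes of `log` at the entries of `y`, with every tail entry replaced by `c`.
  -- They are nondecreasing because `y` is nonincreasing and `c ≤ y i` on the head.
  let w : Fin n → ℝ := fun i => if (i : ℕ) < k then (y i)⁻¹ else c⁻¹
  have hw0 : ∀ i, 0 < w i := fun i => by
    dsimp only [w]
    split_ifs with h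
    · exact inv_pos.2 (hc0.trans_le (hcy i h))
    · exact inv_pos.2 hc0
  have hw : Monotone w := fun i j hij => by
    have hij' : (i : ℕ) ≤ j := hij
    dsimp only [w]
    split_ifs with h1 h2 h2
    · exact inv_anti₀ (hc0.trans_le (hcy j h2)) (hy hij)
    · exact inv_anti₀ hc0 (hcy i h1)
    · omega
    · rfl
  let L : Matrix (Fin n) (Fin n) ℝ →ₗ[ℝ] ℝ :=
    (traceLinearMap (Fin n) ℝ ℝ) ∘ₗ (LinearMap.mulLeft ℝ (U * diagonal w * Uᵀ))
  refine (concaveEnvelope_le_of_affine convex_posSemidef L _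
    (fun Y hY => phi_le_affine hU hU' hY hw hw0) X).trans ?_
  rw [EReal.coe_le_coe_iff]
  have htr : L X = ∑ i, w i * l i := by
    change (U * diagonal w * Uᵀ * X).trace = _
    have : U * diagonal w * Uᵀ * X = U * (diagonal w * diagonal l) * Uᵀ := by
      rw [hXU]
      simp only [Matrix.mul_assoc]
      rw [← Matrix.mul_assoc Uᵀ U, hU', Matrix.one_mul]
    rw [this, trace_mul_comm, ← Matrix.mul_assoc, hU', Matrix.one_mul, diagonal_mul_diagonal,
      trace_diagonal]
  have hsum : ∑ i, w i * y i = ∑ i, w i * l i +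
      ∑ i ∈ Finset.univ.filter (fun i : Fin n => (i : ℕ) < s), t * w i := by
    rw [Finset.sum_filter, ← Finset.sum_add_distrib]
    refine Finset.sum_congr rfl fun i _ => ?_
    simp only [hyX, firstOnes, Pi.add_apply, Pi.smul_apply, smul_eq_mul]
    split_ifs <;> ring
  have hhead : ∑ i ∈ Finset.univ.filter (fun i : Fin n => (i : ℕ) < k), w i * y i =
      ∑ i ∈ Finset.univ.filter (fun i : Fin n => (i : ℕ) < k), (1 : ℝ) := by
    refine Finset.sum_congr rfl fun i hi => ?_
    have hik : (i : ℕ) < k := (Finset.mem_filter.1 hi).2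
    simp only [w, if_pos hik]
    exact inv_mul_cancel₀ (hc0.trans_le (hcy i hik)).ne'
  have htail : ∑ i ∈ Finset.univ.filter (fun i : Fin n => k ≤ (i : ℕ)), w i * y i ≤ (s : ℝ) - k := by
    have : ∑ i ∈ Finset.univ.filter (fun i : Fin n => k ≤ (i : ℕ)), w i * y i =
        c⁻¹ * ∑ i ∈ Finset.univ.filter (fun i : Fin n => k ≤ (i : ℕ)), y i := by
      rw [Finset.mul_sum]
      refine Finset.sum_congr rfl fun i hi => ?_
      have hik : ¬ (i : ℕ) < k := not_lt.2 (Finset.mem_filter.1 hi).2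
      simp only [w, if_neg hik]
    rw [this, inv_mul_le_iff₀ hc0, mul_comm c]
    exact hct
  have hcard : ((Finset.univ.filter fun i : Fin n => k ≤ (i : ℕ) ∧ (i : ℕ) < s).card : ℝ) =
      (s : ℝ) - k := by
    rw [card_filter_le_lt hks.le hsn, Nat.cast_sub hks.le]
  have hlog : ∑ i ∈ Finset.univ.filter (fun i : Fin n => (i : ℕ) < s), (Real.log (w i) + 1) =
      ∑ i ∈ Finset.univ.filter (fun i : Fin n => (i : ℕ) < k), (-Real.log (y i) + 1) +
        ((s : ℝ) - k) * (-Real.log c + 1) := by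
    rw [sum_filter_lt_split hks.le]
    congr 1
    · refine Finset.sum_congr rfl fun i hi => ?_
      simp only [w, if_pos (Finset.mem_filter.1 hi).2, Real.log_inv]
    · rw [← hcard, ← nsmul_eq_mul]
      refine Finset.sum_eq_card_nsmul fun i hi => ?_
      simp only [w, if_neg (not_lt.2 (Finset.mem_filter.1 hi).2.1), Real.log_inv]
  -- The head contributes `k` and the tail at most `s - k` to `∑ w i * y i`, which offsets the `s`
  -- constants `-1` of the tangent lines.
  rw [sum_split k, hhead] at hsum
  simp only [Finset.sum_add_distrib, Finset.sum_neg_distrib] at hlog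
  rw [htr]
  simp only [Finset.sum_sub_distrib]
  linarith

/-! ### Lower bound by convex combinations -/

/-- The spectrum depends on `A` only through its cardinality, so `A` may be exchanged for the
positions `k ≤ i < s`, where the vector is sorted. -/
theorem map_univ_ite_mem {n k p : ℕ} (l : Fin n → ℝ) (a : ℝ) {A : Finset (Fin n)}
    (hA : A ⊆ Finset.univ.filter fun i : Fin n => k ≤ (i : ℕ)) (hp : A.card = p) :
    Finset.univ.val.map (fun i : Fin n => if (i : ℕ) < k then l i else if i ∈ A then a else 0) =
      (Finset.univ.filter fun i : Fin n => (i : ℕ) < k).val.map l + (Multiset.replicate p a +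
        Multiset.replicate ((Finset.univ.filter fun i : Fin n => k ≤ (i : ℕ)).card - p) 0) := by
  set T := Finset.univ.filter fun i : Fin n => k ≤ (i : ℕ) with hT
  have e1 : (Finset.univ : Finset (Fin n)).val =
      (Finset.univ.filter fun i : Fin n => (i : ℕ) < k).val + T.val := by
    rw [hT]
    simp only [← not_lt]
    exact (Multiset.filter_add_not _ _).symm
  have e2 : T.val = A.val + (T \ A).val := by
    rw [Finset.sdiff_val, add_tsub_cancel_of_le (Finset.val_le_iff.2 hA)]
  rw [e1, Multiset.map_add, e2, Multiset.map_add]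
  congr 1
  · exact Multiset.map_congr rfl fun i hi => if_pos (Finset.mem_filter_univ i |>.1 hi)
  congr 1
  · rw [Multiset.map_congr (g := fun _ => a) rfl, Multiset.map_const', ← hp]
    · rfl
    · intro i hi
      have hi' : i ∈ A := hi
      rw [if_neg (not_lt.2 (Finset.mem_filter.1 (hA hi')).2), if_pos hi']
  · rw [Multiset.map_congr (g := fun _ => (0 : ℝ)) rfl, Multiset.map_const', ← hp,
      ← Finset.card_sdiff_of_subset hA]
    · rfl
    · intro i hi
      obtain ⟨h1, h2⟩ := Finset.mem_sdiff.1 hi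
      rw [if_neg (not_lt.2 (Finset.mem_filter.1 h1).2), if_neg h2]

open Matrix in
theorem phi_conj_diagonal_ite {n s k : ℕ} (hsn : s ≤ n) (hks : k < s) (t : ℝ)
    {U : Matrix (Fin n) (Fin n) ℝ} (hU : Uᵀ * U = 1) {l : Fin n → ℝ} (hl : Antitone l) {a : ℝ}
    (ha0 : 0 ≤ a) (hal : ∀ i : Fin n, (i : ℕ) < k → a ≤ l i) {A : Finset (Fin n)}
    (hA : A ⊆ Finset.univ.filter fun i : Fin n => k ≤ (i : ℕ)) (hcard : A.card = s - k) :
    phi s (U * diagonal (fun i : Fin n => if (i : ℕ) < k then l i else if i ∈ A then a else 0) * Uᵀ) t =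
      ∑ i ∈ Finset.univ.filter (fun i : Fin n => (i : ℕ) < k), extLog (l i + t) +
        (s - k) • extLog (a + t) := by
  set B := Finset.univ.filter fun i : Fin n => k ≤ (i : ℕ) ∧ (i : ℕ) < s with hB
  have hBT : B ⊆ Finset.univ.filter fun i : Fin n => k ≤ (i : ℕ) :=
    Finset.monotone_filter_right _ fun i _ hi => hi.1
  have hBc : B.card = s - k := card_filter_le_lt hks.le hsn
  have hv : Antitone fun i : Fin n => if (i : ℕ) < k then l i else if i ∈ B then a else 0 := by
    intro i j hij
    have hij' : (i : ℕ) ≤ j := hij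
    simp only [hB, Finset.mem_filter, Finset.mem_univ, true_and]
    by_cases hj : (j : ℕ) < k
    · rw [if_pos hj, if_pos (by omega)]
      exact hl hij
    rw [if_neg hj]
    by_cases hjs : (j : ℕ) < s
    · rw [if_pos ⟨not_lt.1 hj, hjs⟩]
      split_ifs with h1 h2
      · exact hal i h1
      · rfl
      · omega
    · rw [if_neg fun h => hjs h.2]
      split_ifs with h1 h2
      · exact ha0.trans (hal i h1)
      · exact ha0
      · rfl
  have hev := sortedEigenvalues_conj_diagonal hU hv
    ((map_univ_ite_mem l a hA hcard).trans (map_univ_ite_mem l a hBT hBc).symm)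
  rw [phi, hev, sum_filter_lt_split hks.le, ← hBc]
  congr 1
  · exact Finset.sum_congr rfl fun i hi => by
      dsimp only
      rw [if_pos (Finset.mem_filter.1 hi).2]
  · refine Finset.sum_eq_card_nsmul fun i hi => ?_
    dsimp only
    rw [if_neg (not_lt.2 (Finset.mem_filter.1 hi).2.1), if_pos hi]

-- Any concave majorant is at least `r` at all vertex matrices, hence at `X`. The level `r` is real
-- because hypographs contain only real heights.
open Matrix in
theorem le_concaveEnvelope_phi {n s k : ℕ} (hsn : s ≤ n) (hks : k < s) {t : ℝ}
    {X : Matrix (Fin n) (Fin n) ℝ} (hX : X.PosSemidef) {a : ℝ}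
    (hal : ∀ i : Fin n, (i : ℕ) < k → a ≤ sortedEigenvalues X i)
    (hla : ∀ i : Fin n, k ≤ (i : ℕ) → sortedEigenvalues X i ≤ a)
    (hsum : ∑ i ∈ Finset.univ.filter (fun i : Fin n => k ≤ (i : ℕ)), sortedEigenvalues X i =
      ((s : ℝ) - k) * a) {r : ℝ}
    (hr : (r : EReal) = ∑ i ∈ Finset.univ.filter (fun i : Fin n => (i : ℕ) < k),
      extLog (sortedEigenvalues X i + t) + (s - k) • extLog (a + t)) :
    (r : EReal) ≤
      concaveEnvelope {Y : Matrix (Fin n) (Fin n) ℝ | Y.PosSemidef} (fun Y => phi s Y t) X := by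
  refine le_iInf₂ fun g ⟨⟨_, hg⟩, hphi⟩ => ?_
  obtain ⟨U, -, hU, hXU⟩ := exists_orthogonal_diagonalization hX.1
  have hl0 := sortedEigenvalues_nonneg hX
  have hl := antitone_sortedEigenvalues X
  set l := sortedEigenvalues X
  have ha0 : 0 ≤ a := (hl0 ⟨k, by omega⟩).trans (hla _ le_rfl)
  set T := Finset.univ.filter fun i : Fin n => k ≤ (i : ℕ) with hT
  let M : (Fin n → ℝ) → Matrix (Fin n) (Fin n) ℝ := fun v =>
    U * diagonal (fun i : Fin n => if (i : ℕ) < k then l i else a * v i) * Uᵀ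
  have hMcomb : ∀ (v w : Fin n → ℝ) (p q : ℝ), p + q = 1 →
      M (p • v + q • w) = p • M v + q • M w := by
    intro v w p q hpq
    have hD : diagonal (fun i : Fin n => if (i : ℕ) < k then l i else a * (p • v + q • w) i) =
        p • diagonal (fun i : Fin n => if (i : ℕ) < k then l i else a * v i) +
          q • diagonal (fun i : Fin n => if (i : ℕ) < k then l i else a * w i) := by
      rw [← diagonal_smul, ← diagonal_smul, diagonal_add]
      congr 1
      funext i
      simp only [Pi.add_apply, Pi.smul_apply, smul_eq_mul]
      split_ifs
      · rw [← add_mul, hpq, one_mul]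
      · ring
    simp only [M, hD, Matrix.mul_add, Matrix.add_mul, Matrix.mul_smul, Matrix.smul_mul]
  -- The map `M` is affine, so this is the preimage of a slice of the convex hypograph of `g`.
  let S : Set (Fin n → ℝ) := {v | (M v).PosSemidef ∧ (r : EReal) ≤ g (M v)}
  have hS : Convex ℝ S := by
    intro v hv w hw p q hp hq hpq
    have h := hg (x := (M v, r)) hv (y := (M w, r)) hw hp hq hpq
    have hrr : p * r + q * r = r := by rw [← add_mul, hpq, one_mul]
    simpa only [S, Set.mem_ofPred_eq, hMcomb v w p q hpq, Prod.smul_mk, Prod.mk_add_mk,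
      smul_eq_mul, hrr] using h
  have hvert : ∀ A ⊆ T, A.card = s - k → (fun i => if i ∈ A then (1 : ℝ) else 0) ∈ S := by
    intro A hA hcard
    have hM : M (fun i => if i ∈ A then (1 : ℝ) else 0) =
        U * diagonal (fun i : Fin n => if (i : ℕ) < k then l i else if i ∈ A then a else 0) * Uᵀ := by
      simp only [M, mul_ite, mul_one, mul_zero]
    have hpsd : (M fun i => if i ∈ A then (1 : ℝ) else 0).PosSemidef := by
      rw [hM, ← conjTranspose_eq_transpose_of_trivial]
      refine PosSemidef.mul_mul_conjTranspose_same (posSemidef_diagonal_iff.2 fun i => ?_) U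
      split_ifs
      exacts [hl0 i, ha0, le_rfl]
    refine ⟨hpsd, ?_⟩
    rw [hr, ← phi_conj_diagonal_ite hsn hks t hU hl ha0 hal hA hcard, ← hM]
    exact hphi _ hpsd
  have hsk : ((s - k : ℕ) : ℝ) = (s : ℝ) - k := Nat.cast_sub hks.le
  suffices H : ∃ v ∈ hypersimplex T (s - k), M v = X by
    obtain ⟨v, hv, hvX⟩ := H
    exact hvX ▸ (hypersimplex_subset_of_convex hS hvert hv).2
  -- If `a = 0`, the tail eigenvalues vanish and any point of the hypersimplex serves. Otherwise the
  -- point is the tail divided by `a`.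
  rcases ha0.eq_or_lt with ha | ha
  · refine ⟨fun i => if k ≤ (i : ℕ) ∧ (i : ℕ) < s then 1 else 0, ⟨fun i _ => ?_, fun i hi => ?_,
      ?_⟩, ?_⟩
    · dsimp only
      split_ifs <;> norm_num
    · have : ¬ k ≤ (i : ℕ) := by simpa [hT] using hi
      simp [this]
    · rw [Finset.sum_boole, hT, Finset.filter_filter, ← card_filter_le_lt hks.le hsn]
      congr 3
      ext i
      tauto
    · conv_rhs => rw [hXU]
      simp only [M]
      congr 3
      funext i
      by_cases h1 : (i : ℕ) < k
      · rw [if_pos h1]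
      · rw [if_neg h1, ← ha, zero_mul]
        exact le_antisymm (hl0 i) (ha ▸ hla i (not_lt.1 h1))
  · refine ⟨fun i => if (i : ℕ) < k then 0 else l i / a, ⟨fun i hi => ?_, fun i hi => ?_, ?_⟩, ?_⟩
    · have hi' : k ≤ (i : ℕ) := (Finset.mem_filter.1 hi).2
      simp only [if_neg (not_lt.2 hi')]
      exact ⟨div_nonneg (hl0 i) ha0, (div_le_one ha).2 (hla i hi')⟩
    · have : (i : ℕ) < k := by simpa [hT] using hi
      simp [this]
    · rw [hsk, ← mul_div_cancel_right₀ ((s : ℝ) - k) ha.ne', ← hsum, Finset.sum_div]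
      exact Finset.sum_congr rfl fun i hi => if_neg (not_lt.2 (Finset.mem_filter.1 hi).2)
    · conv_rhs => rw [hXU]
      simp only [M]
      congr 3
      funext i
      split_ifs with h1
      · rfl
      · exact mul_div_cancel₀ _ ha.ne'

/-! ### The envelope formula -/

theorem proposition2 (n s : ℕ) (hs : 1 ≤ s) (hsn : s ≤ n)
    (C : Matrix (Fin n) (Fin n) ℝ) (hC : C.PosDef)
    (t : ℝ) (ht₀ : 0 ≤ t) (ht : t ≤ lambdaMin C)
    (X : Matrix (Fin n) (Fin n) ℝ) (hX : X.PosSemidef) :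
    concaveEnvelope {Y : Matrix (Fin n) (Fin n) ℝ | Y.PosSemidef} (fun Y => phi s Y t) X =
      psi s (sortedEigenvalues X + t • firstOnes n s) := by
  have hl0 := sortedEigenvalues_nonneg hX
  have hl := antitone_sortedEigenvalues X
  obtain ⟨y, hyX⟩ : ∃ y, y = sortedEigenvalues X + t • firstOnes n s := ⟨_, rfl⟩
  have hy_lt : ∀ i : Fin n, (i : ℕ) < s → y i = sortedEigenvalues X i + t := fun i hi => by
    simp [hyX, firstOnes, hi]
  have hy_ge : ∀ i : Fin n, ¬ (i : ℕ) < s → y i = sortedEigenvalues X i := fun i hi => by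
    simp [hyX, firstOnes, hi]
  have hy0 : ∀ i, 0 ≤ y i := fun i => by
    by_cases hi : (i : ℕ) < s
    · rw [hy_lt i hi]; linarith [hl0 i]
    · rw [hy_ge i hi]; exact hl0 i
  have hy : Antitone y := fun i j hij => by
    have hij' : (i : ℕ) ≤ j := hij
    have := hl hij
    by_cases hi : (i : ℕ) < s <;> by_cases hj : (j : ℕ) < s
    · rw [hy_lt i hi, hy_lt j hj]; linarith
    · rw [hy_lt i hi, hy_ge j hj]; linarith
    · omega
    · rw [hy_ge i hi, hy_ge j hj]; linarith
  obtain ⟨k, hk, -⟩ := existsUnique_isPsiIndex hs hsn y hy0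
  rw [← hyX, psi_eq hs hsn hy0 hk]
  obtain ⟨hks, hk1, hk2⟩ := hk
  have hsk : (0 : ℝ) < (s : ℝ) - k := by
    have : (k : ℝ) < s := by exact_mod_cast hks
    linarith
  obtain ⟨c, hc⟩ : ∃ c, c = tailSum y k / ((s : ℝ) - k) := ⟨_, rfl⟩
  rw [← hc] at hk1 hk2 ⊢
  rw [tailSum] at hc
  rw [sortDesc_eq_self hy] at hc hk1 hk2 ⊢
  have hct : ∑ i ∈ Finset.univ.filter (fun i : Fin n => k ≤ (i : ℕ)), y i = ((s : ℝ) - k) * c := by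
    rw [hc]; field_simp
  have hc0 : 0 ≤ c := hc ▸ div_nonneg (Finset.sum_nonneg fun i _ => hy0 i) hsk.le
  have hcy : ∀ i : Fin n, (i : ℕ) < k → c ≤ y i := fun i hi =>
    (hk1 ⟨k - 1, by omega⟩ (by dsimp only; omega)).le.trans
      (hy (by rw [Fin.le_def]; dsimp only; omega))
  rcases hc0.eq_or_lt with hcz | hcpos
  -- For `c = 0` the right-hand side is `-∞`. The first `k` entries of `y` are still positive, so a
  -- positive `c₀` below them exists.
  · obtain ⟨c₀, hc₀, hc₀y⟩ : ∃ c₀, 0 < c₀ ∧ ∀ i : Fin n, (i : ℕ) < k → c₀ ≤ y i := by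
      rcases Nat.eq_zero_or_pos k with rfl | hkpos
      · exact ⟨1, one_pos, fun i hi => absurd hi (Nat.not_lt_zero _)⟩
      · refine ⟨y ⟨k - 1, by omega⟩, ?_, fun i hi => hy (by rw [Fin.le_def]; dsimp only; omega)⟩
        rw [hcz]
        exact hk1 _ (by dsimp only; omega)
    obtain ⟨m, hm⟩ : ∃ m, s - k = m + 1 := ⟨s - k - 1, by omega⟩
    rw [← hcz, extLog_of_nonpos le_rfl, hm, succ_nsmul, EReal.add_bot, EReal.add_bot,
      EReal.eq_bot_iff_forall_lt]
    intro r
    set B := ∑ i ∈ Finset.univ.filter (fun i : Fin n => (i : ℕ) < k), Real.log (y i)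
    -- The exponential makes `B + (s - k) * log c'` at most `r - 1`.
    set c' := min c₀ (Real.exp ((r - 1 - B) / ((s : ℝ) - k)))
    have hc' : 0 < c' := lt_min hc₀ (Real.exp_pos _)
    refine (concaveEnvelope_phi_le hsn hks hX.1 hy hyX hc'
      (fun i hi => (min_le_left _ _).trans (hc₀y i hi)) ?_).trans_lt ?_
    · rw [hct, ← hcz, mul_zero]
      positivity
    · rw [EReal.coe_lt_coe_iff]
      have h1 : Real.log c' ≤ (r - 1 - B) / ((s : ℝ) - k) :=
        (Real.log_le_iff_le_exp hc').2 (min_le_right _ _)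
      rw [le_div_iff₀ hsk] at h1
      linarith
  · have hval : ((∑ i ∈ Finset.univ.filter (fun i : Fin n => (i : ℕ) < k), Real.log (y i) +
        ((s : ℝ) - k) * Real.log c : ℝ) : EReal) =
        ∑ i ∈ Finset.univ.filter (fun i : Fin n => (i : ℕ) < k), extLog (y i) +
          (s - k) • extLog c := by
      rw [extLog_of_pos hcpos, EReal.coe_add, EReal.coe_finset_sum, ← Nat.cast_sub hks.le,
        ← nsmul_eq_mul, EReal.coe_nsmul]
      congr 1
      exact Finset.sum_congr rfl fun i hi =>
        (extLog_of_pos (hcpos.trans_le (hcy i (Finset.mem_filter.1 hi).2))).symm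
    rw [← hval]
    refine le_antisymm (concaveEnvelope_phi_le hsn hks hX.1 hy hyX hcpos hcy hct.le) ?_
    -- The shift `t` enters each of the `s - k` tail entries of index below `s`, so removing it
    -- lowers their common value from `c` to `c - t`. The index condition `y_{k+1} ≤ c` puts the
    -- tail eigenvalues below `c - t`.
    refine le_concaveEnvelope_phi hsn hks (a := c - t) hX (fun i hi => ?_) (fun i hi => ?_) ?_ ?_
    · have := hcy i hi
      rw [hy_lt i (hi.trans hks)] at this
      linarith
    · have h1 := hk2 ⟨k, by omega⟩ rfl
      rw [hy_lt ⟨k, by omega⟩ hks] at h1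
      have h2 : sortedEigenvalues X i ≤ sortedEigenvalues X ⟨k, by omega⟩ := hl hi
      linarith
    · have h1 : ∑ i ∈ Finset.univ.filter (fun i : Fin n => k ≤ (i : ℕ)), y i =
          ∑ i ∈ Finset.univ.filter (fun i : Fin n => k ≤ (i : ℕ)), sortedEigenvalues X i +
            ((s : ℝ) - k) * t := by
        rw [← Nat.cast_sub hks.le, ← card_filter_le_lt hks.le hsn, ← nsmul_eq_mul,
          ← Finset.sum_const, ← Finset.filter_filter, Finset.sum_filter (p := fun i : Fin n => _ < s),
          ← Finset.sum_add_distrib]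
        refine Finset.sum_congr rfl fun i _ => ?_
        split_ifs with h
        · exact hy_lt i h
        · rw [hy_ge i h, add_zero]
      linarith
    · rw [hval, sub_add_cancel]
      congr 1
      exact Finset.sum_congr rfl fun i hi => by
        rw [hy_lt i ((Finset.mem_filter.1 hi).2.trans hks)]
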